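/- Let $\mathbf{pInj}$ be the category of sets and partial injections, with the symmetric monoidal tensor given by disjoint union $\uplus$ (unit $\emptyset$), traced by \[ \mathrm{Tr}^U_{X,Y}\begin{pmatrix} f_{00} & f_{01}\\ f_{10} & f_{11}\end{pmatrix} = f_{00}\cup\bigcup_{j\ge 0} f_{01}f_{11}^{\,j}f_{10} \qquad (X\uplus U\to Y\uplus U), \] and let $\mathbf{pNat}$ be its full (traced, symmetric) monoidal subcategory generated by $\mathbb N$: its objects are the sets obtained from $\mathbb N$ and $\emptyset$ by finitely many disjoint unions. Let $\mathbf{Int(pNat)}$ be the result of applying the Joyal--Street--Verity $\mathbf{Int}$ construction to $\mathbf{pNat}$: objects are pairs $(X,U)$ of objects of $\mathbf{pNat}$; morphisms $(X,U)\to(Y,V)$ are the partial injections $X\uplus V\to Y\uplus U$; the composite of $f:(X,U)\to(Y,V)$ and $g:(Y,V)\to(Z,W)$ is the trace over $V$ of the composite of $f\uplus 1_W$ followed by $g\uplus 1_U$ (up to symmetries); the tensor is $(X,U)\,\Box\,(X',U')=(X\uplus X',U'\uplus U)$, with unit object $(\emptyset,\emptyset)$; the dual is $(X,U)^*=(U,X)$;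 and the unit $\eta:(\emptyset,\emptyset)\to(X,U)\Box(U,X)$ and counit $\epsilon:(U,X)\Box(X,U)\to(\emptyset,\emptyset)$ are the symmetries $\emptyset\uplus(X\uplus U)\to(X\uplus U)\uplus\emptyset$ and $(U\uplus X)\uplus\emptyset\to\emptyset\uplus(U\uplus X)$. \begin{enumerate} \item $\mathbf{Int(pNat)}$, with this structure, is a compact closed category (a symmetric monoidal category in which $\eta,\epsilon$ exhibit $(X,U)^*$ as a dual of $(X,U)$), and all of its objects $(X,U)$ with $X\not\cong\emptyset\not\cong U$ (that is, with $X$ and $U$ both nonempty) are isomorphic to each other. \item Let $\mathbf{IpN}$ be the full monoidal subcategory of $\mathbf{Int(pNat)}$ generated by the object $(\mathbb N,\mathbb N)$, that is, the full subcategory on the objects obtained from $(\mathbb N,\mathbb N)$ and $(\emptyset,\emptyset)$ by finitely many tensors $\Box$. Then $\mathbf{IpN}$ is closed under $(\ )^*$ and is a compact closed category, with the tensor, dual, unit and counit inherited from $\mathbf{Int(pNat)}$, and all of its non-unit objects (those not isomorphic to the unit object $(\emptyset,\emptyset)$) are isomorphic to each other. \end{enumerate} -/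

import Mathlib

open CategoryTheory MonoidalCategory

/-- A compact closed category: a symmetric monoidal category in which every object `A` has a dual
`A*`, exhibited by a unit `η : I ⟶ A ⊗ A*` and a counit `ε : A* ⊗ A ⟶ I` satisfying the triangle
identities. -/
def IsCompactClosed {C : Type*} [Category C] [MonoidalCategory C] [SymmetricCategory C]
    (dual : C → C) (η : ∀ A : C, 𝟙_ C ⟶ A ⊗ dual A) (ε : ∀ A : C, dual A ⊗ A ⟶ 𝟙_ C) : Prop :=
  ∀ A : C, ∃ p : ExactPairing A (dual A), p.coevaluation' = η A ∧ p.evaluation' = ε A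

namespace PartialInj

/-- The partial injection with a given graph. -/
noncomputable def ofRel {X Y : Type} (r : X → Y → Prop)
    (hfun : ∀ x y y', r x y → r x y' → y = y')
    (hinj : ∀ x x' y, r x y → r x' y → x = x') : X ≃. Y where
  toFun x := open Classical in if h : ∃ y, r x y then some h.choose else none
  invFun y := open Classical in if h : ∃ x, r x y then some h.choose else none
  inv x y := by
    have h₁ : ∀ x y, (y ∈ (open Classical in if h : ∃ y, r x y then some h.choose else none)) ↔
        r x y := by
      intro x y
      split_ifs with h
      · simp only [Option.mem_def, Option.some.injEq]
        exact ⟨fun e => e ▸ h.choose_spec, fun e => hfun _ _ _ h.choose_spec e⟩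
      · simpa using fun e => h ⟨y, e⟩
    have h₂ : ∀ x y, (x ∈ (open Classical in if h : ∃ x, r x y then some h.choose else none)) ↔
        r x y := by
      intro x y
      split_ifs with h
      · simp only [Option.mem_def, Option.some.injEq]
        exact ⟨fun e => e ▸ h.choose_spec, fun e => hinj _ _ _ h.choose_spec e⟩
      · simpa using fun e => h ⟨x, e⟩
    exact (h₂ x y).trans (h₁ x y).symm

theorem mem_ofRel {X Y : Type} {r : X → Y → Prop} {hfun hinj} {x : X} {y : Y} :
    y ∈ ofRel r hfun hinj x ↔ r x y := by
  change y ∈ (open Classical in if h : ∃ y, r x y then some h.choose else none) ↔ r x y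
  split_ifs with h
  · simp only [Option.mem_def, Option.some.injEq]
    exact ⟨fun e => e ▸ h.choose_spec, fun e => hfun _ _ _ h.choose_spec e⟩
  · simpa using fun e => h ⟨y, e⟩

theorem ext_mem {X Y : Type} {f g : X ≃. Y} (h : ∀ x y, y ∈ f x ↔ y ∈ g x) : f = g :=
  PEquiv.ext fun x => Option.ext fun y => h x y

/-- Disjoint union of partial injections. -/
def sumMap {A B C D : Type} (f : A ≃. B) (g : C ≃. D) : A ⊕ C ≃. B ⊕ D where
  toFun := Sum.elim (fun a => (f a).map Sum.inl) (fun c => (g c).map Sum.inr)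
  invFun := Sum.elim (fun b => (f.symm b).map Sum.inl) (fun d => (g.symm d).map Sum.inr)
  inv x y := by
    rcases x with a | c <;> rcases y with b | d <;> simp [PEquiv.eq_some_iff]

section
variable {A B C D : Type} (f : A ≃. B) (g : C ≃. D)
@[simp] theorem sumMap_ll {a b} : Sum.inl b ∈ sumMap f g (Sum.inl a) ↔ b ∈ f a := by
  simp [sumMap]
@[simp] theorem sumMap_lr {a d} : ¬ (Sum.inr d ∈ sumMap f g (Sum.inl a)) := by
  simp [sumMap]
@[simp] theorem sumMap_rl {c b} : ¬ (Sum.inl b ∈ sumMap f g (Sum.inr c)) := by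
  simp [sumMap]
@[simp] theorem sumMap_rr {c d} : Sum.inr d ∈ sumMap f g (Sum.inr c) ↔ d ∈ g c := by
  simp [sumMap]
end

/-- The graph of the trace of `f : X ⊎ U ⇀ Y ⊎ U`: the union
`f₀₀ ∪ ⋃ⱼ f₀₁ f₁₁ʲ f₁₀`, where `⋃ⱼ f₁₁ʲ` is the reflexive transitive closure of `f₁₁`. -/
def TraceRel {X Y U : Type} (f : X ⊕ U ≃. Y ⊕ U) (x : X) (y : Y) : Prop :=
  Sum.inl y ∈ f (Sum.inl x) ∨
    ∃ u v, Sum.inr u ∈ f (Sum.inl x) ∧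
      Relation.ReflTransGen (fun u u' => Sum.inr u' ∈ f (Sum.inr u)) u v ∧
      Sum.inl y ∈ f (Sum.inr v)

theorem TraceRel.functional {X Y U : Type} {f : X ⊕ U ≃. Y ⊕ U} {x : X} {y y' : Y}
    (h : TraceRel f x y) (h' : TraceRel f x y') : y = y' := by
  have det : ∀ {i : X ⊕ U} {o o' : Y ⊕ U}, o ∈ f i → o' ∈ f i → o = o' :=
    fun h h' => Option.mem_unique h h'
  rcases h with h | ⟨u, v, h1, h2, h3⟩ <;> rcases h' with h' | ⟨u', v', h1', h2', h3'⟩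
  · exact Sum.inl_injective (det h h')
  · cases det h h1'
  · cases det h1 h'
  · obtain rfl := Sum.inr_injective (det h1 h1')
    clear h1 h1'
    induction h2 using Relation.ReflTransGen.head_induction_on with
    | refl =>
      rcases Relation.ReflTransGen.cases_head h2' with rfl | ⟨c, hc, -⟩
      · exact Sum.inl_injective (det h3 h3')
      · cases det h3 hc
    | head ha _ ih =>
      rcases Relation.ReflTransGen.cases_head h2' with rfl | ⟨c, hc, hc'⟩
      · cases det h3' ha
      · obtain rfl := Sum.inr_injective (det ha hc)
        exact ih hc'

theorem TraceRel.symm {X Y U : Type} {f : X ⊕ U ≃. Y ⊕ U} {x : X} {y : Y}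
    (h : TraceRel f x y) : TraceRel f.symm y x := by
  rcases h with h | ⟨u, v, h1, h2, h3⟩
  · exact Or.inl ((f.mem_iff_mem).2 h)
  · refine Or.inr ⟨v, u, (f.mem_iff_mem).2 h3, ?_, (f.mem_iff_mem).2 h1⟩
    have h := Relation.ReflTransGen.swap _ _ h2
    refine Relation.ReflTransGen.lift id (fun a b hab => ?_) _ _ h
    exact (f.mem_iff_mem).2 hab

/-- The trace of partial injections with respect to disjoint union. -/
noncomputable def trace {X Y U : Type} (f : X ⊕ U ≃. Y ⊕ U) : X ≃. Y :=
  ofRel (TraceRel f) (fun _ _ _ h h' => h.functional h')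
    (fun _ _ _ h h' => h.symm.functional h'.symm)

/-- The rearrangement `(A ⊎ B) ⊎ C ≅ (A ⊎ C) ⊎ B`. -/
def swapRight (A B C : Type) : (A ⊕ B) ⊕ C ≃ (A ⊕ C) ⊕ B :=
  (Equiv.sumAssoc A B C).trans
    (((Equiv.refl A).sumCongr (Equiv.sumComm B C)).trans (Equiv.sumAssoc A C B).symm)

/-- For `f : X ⊎ V ⇀ Y ⊎ U` and `g : Y ⊎ W ⇀ Z ⊎ V`, the composite
`(X ⊎ W) ⊎ V ≅ (X ⊎ V) ⊎ W ⇀ (Y ⊎ U) ⊎ W ≅ (Y ⊎ W) ⊎ U ⇀ (Z ⊎ V) ⊎ U ≅ (Z ⊎ U) ⊎ V`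
of symmetries with `f ⊎ 1` and `g ⊎ 1`. -/
def glue {X U Y V Z W : Type} (f : X ⊕ V ≃. Y ⊕ U) (g : Y ⊕ W ≃. Z ⊕ V) :
    (X ⊕ W) ⊕ V ≃. (Z ⊕ U) ⊕ V :=
  (swapRight X W V).toPEquiv.trans <| (sumMap f (PEquiv.refl W)).trans <|
    (swapRight Y U W).toPEquiv.trans <| (sumMap g (PEquiv.refl U)).trans <|
      (swapRight Z V U).toPEquiv

/-- Composition in the `Int` construction, of `f : (X, U) ⟶ (Y, V)` and `g : (Y, V) ⟶ (Z, W)`: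
feed the output wire `V` of `g` back into the input wire `V` of `f`. -/
noncomputable def intComp {X U Y V Z W : Type} (f : X ⊕ V ≃. Y ⊕ U) (g : Y ⊕ W ≃. Z ⊕ V) :
    X ⊕ W ≃. Z ⊕ U :=
  trace (glue f g)

/-! Composition is computed by following a token along the wires of the two morphisms. -/

/-- The wires of `f : (X, U) ⟶ (Y, V)` followed by `g : (Y, V) ⟶ (Z, W)`. -/
inductive Wire (X U Y V Z W : Type)
  | x (a : X) | u (a : U) | y (a : Y) | v (a : V) | z (a : Z) | w (a : W)

/-- One pass of a token through `f` or `g`. -/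
inductive Step {X U Y V Z W : Type} (f : X ⊕ V ≃. Y ⊕ U) (g : Y ⊕ W ≃. Z ⊕ V) :
    Wire X U Y V Z W → Wire X U Y V Z W → Prop
  | xy {a b} : Sum.inl b ∈ f (Sum.inl a) → Step f g (.x a) (.y b)
  | xu {a b} : Sum.inr b ∈ f (Sum.inl a) → Step f g (.x a) (.u b)
  | vy {a b} : Sum.inl b ∈ f (Sum.inr a) → Step f g (.v a) (.y b)
  | vu {a b} : Sum.inr b ∈ f (Sum.inr a) → Step f g (.v a) (.u b)
  | yz {a b} : Sum.inl b ∈ g (Sum.inl a) → Step f g (.y a) (.z b)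
  | yv {a b} : Sum.inr b ∈ g (Sum.inl a) → Step f g (.y a) (.v b)
  | wz {a b} : Sum.inl b ∈ g (Sum.inr a) → Step f g (.w a) (.z b)
  | wv {a b} : Sum.inr b ∈ g (Sum.inr a) → Step f g (.w a) (.v b)

section
variable {X U Y V Z W : Type}
def win : X ⊕ W → Wire X U Y V Z W := Sum.elim .x .w
def wout : Z ⊕ U → Wire X U Y V Z W := Sum.elim .z .u
def gin : (X ⊕ W) ⊕ V → Wire X U Y V Z W := Sum.elim win .v
def gout : (Z ⊕ U) ⊕ V → Wire X U Y V Z W := Sum.elim wout .v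

variable (f : X ⊕ V ≃. Y ⊕ U) (g : Y ⊕ W ≃. Z ⊕ V)

theorem mem_glue_x {a : X} {o} : o ∈ glue f g (.inl (.inl a)) ↔
    (∃ b, .inr b ∈ f (.inl a) ∧ o = .inl (.inr b)) ∨
    (∃ b c, .inl b ∈ f (.inl a) ∧ .inl c ∈ g (.inl b) ∧ o = .inl (.inl c)) ∨
    (∃ b c, .inl b ∈ f (.inl a) ∧ .inr c ∈ g (.inl b) ∧ o = .inr c) := by
  rcases o with (o | o) | o <;>
  simp [glue, swapRight, PEquiv.trans_eq_some, sumMap, Equiv.toPEquiv_apply]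
theorem mem_glue_v {a : V} {o} : o ∈ glue f g (.inr a) ↔
    (∃ b, .inr b ∈ f (.inr a) ∧ o = .inl (.inr b)) ∨
    (∃ b c, .inl b ∈ f (.inr a) ∧ .inl c ∈ g (.inl b) ∧ o = .inl (.inl c)) ∨
    (∃ b c, .inl b ∈ f (.inr a) ∧ .inr c ∈ g (.inl b) ∧ o = .inr c) := by
  rcases o with (o | o) | o <;>
  simp [glue, swapRight, PEquiv.trans_eq_some, sumMap, Equiv.toPEquiv_apply]
theorem mem_glue_w {a : W} {o} : o ∈ glue f g (.inl (.inr a)) ↔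
    (∃ c, .inl c ∈ g (.inr a) ∧ o = .inl (.inl c)) ∨
    (∃ c, .inr c ∈ g (.inr a) ∧ o = .inr c) := by
  rcases o with (o | o) | o <;>
  simp [glue, swapRight, PEquiv.trans_eq_some, sumMap, Equiv.toPEquiv_apply]

theorem glue_step {i o} (h : o ∈ glue f g i) :
    Relation.ReflTransGen (Step f g) (gin i) (gout o) := by
  rcases i with (a | a) | a
  · rcases (mem_glue_x f g).1 h with ⟨b, h1, rfl⟩ | ⟨b, c, h1, h2, rfl⟩ | ⟨b, c, h1, h2, rfl⟩
    · exact .single (.xu h1)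
    · exact .head (.xy h1) (.single (.yz h2))
    · exact .head (.xy h1) (.single (.yv h2))
  · rcases (mem_glue_w f g).1 h with ⟨b, h1, rfl⟩ | ⟨b, h1, rfl⟩
    · exact .single (.wz h1)
    · exact .single (.wv h1)
  · rcases (mem_glue_v f g).1 h with ⟨b, h1, rfl⟩ | ⟨b, c, h1, h2, rfl⟩ | ⟨b, c, h1, h2, rfl⟩
    · exact .single (.vu h1)
    · exact .head (.vy h1) (.single (.yz h2))
    · exact .head (.vy h1) (.single (.yv h2))

def FromV (a : V) (o : Z ⊕ U) : Prop :=
  ∃ b, Relation.ReflTransGen (fun u u' => Sum.inr u' ∈ glue f g (Sum.inr u)) a b ∧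
      Sum.inl o ∈ glue f g (Sum.inr b)

def Fate (o : Z ⊕ U) : Wire X U Y V Z W → Prop
  | .x a => TraceRel (glue f g) (.inl a) o
  | .w a => TraceRel (glue f g) (.inr a) o
  | .v a => FromV f g a o
  | .y a => (∃ c, .inl c ∈ g (.inl a) ∧ o = .inl c) ∨ ∃ c, .inr c ∈ g (.inl a) ∧ FromV f g c o
  | .z a => o = .inl a
  | .u a => o = .inr a

theorem fate_of_path {o : Z ⊕ U} {s} (h : Relation.ReflTransGen (Step f g) s (wout o)) :
    Fate f g o s := by
  have hd : ∀ {a c o}, Sum.inr c ∈ glue f g (Sum.inr a) → FromV f g c o → FromV f g a o := by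
    rintro a c o h ⟨b, h1, h2⟩
    exact ⟨b, .head h h1, h2⟩
  have hi : ∀ {i c o}, Sum.inr c ∈ glue f g (Sum.inl i) → FromV f g c o →
      TraceRel (glue f g) i o := by
    rintro i c o h ⟨b, h1, h2⟩
    exact Or.inr ⟨c, b, h, h1, h2⟩
  induction h using Relation.ReflTransGen.head_induction_on with
  | refl => rcases o with o | o <;> rfl
  | head hs _ ih =>
    cases hs with
    | xy h =>
      rcases ih with ⟨c, h1, rfl⟩ | ⟨c, h1, h2⟩
      · exact Or.inl ((mem_glue_x f g).2 (.inr (.inl ⟨_, _, h, h1, rfl⟩)))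
      · exact hi ((mem_glue_x f g).2 (.inr (.inr ⟨_, _, h, h1, rfl⟩))) h2
    | xu h =>
      obtain rfl : o = _ := ih
      exact Or.inl ((mem_glue_x f g).2 (.inl ⟨_, h, rfl⟩))
    | vy h =>
      rcases ih with ⟨c, h1, rfl⟩ | ⟨c, h1, h2⟩
      · exact ⟨_, .refl, ((mem_glue_v f g).2 (.inr (.inl ⟨_, _, h, h1, rfl⟩)))⟩
      · exact hd ((mem_glue_v f g).2 (.inr (.inr ⟨_, _, h, h1, rfl⟩))) h2
    | vu h =>
      obtain rfl : o = _ := ih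
      exact ⟨_, .refl, ((mem_glue_v f g).2 (.inl ⟨_, h, rfl⟩))⟩
    | yz h =>
      obtain rfl : o = _ := ih
      exact .inl ⟨_, h, rfl⟩
    | yv h => exact .inr ⟨_, h, ih⟩
    | wz h =>
      obtain rfl : o = _ := ih
      exact Or.inl ((mem_glue_w f g).2 (.inl ⟨_, h, rfl⟩))
    | wv h => exact hi ((mem_glue_w f g).2 (.inr ⟨_, h, rfl⟩)) ih

theorem mem_intComp {i o} : o ∈ intComp f g i ↔
    Relation.ReflTransGen (Step f g) (win i) (wout o) := by
  rw [intComp, trace, mem_ofRel]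
  constructor
  · rintro (h | ⟨u, v, h1, h2, h3⟩)
    · exact glue_step f g h
    · refine (glue_step f g h1).trans (.trans ?_ (glue_step f g h3))
      refine Relation.ReflTransGen.lift' Wire.v (fun a b hab => ?_) _ _ h2
      exact glue_step f g hab
  · intro h
    have := fate_of_path f g h
    rcases i with i | i <;> exact this


end

section assoc
variable {X U Y V Z W T Q : Type}
variable (f : X ⊕ V ≃. Y ⊕ U) (g : Y ⊕ W ≃. Z ⊕ V) (h : Z ⊕ Q ≃. T ⊕ W)

inductive Wire3 (X U Y V Z W T Q : Type)
  | x (a : X) | u (a : U) | y (a : Y) | v (a : V) | z (a : Z) | w (a : W) | t (a : T) | q (a : Q)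

inductive Step3 : Wire3 X U Y V Z W T Q → Wire3 X U Y V Z W T Q → Prop
  | xy {a b} : Sum.inl b ∈ f (Sum.inl a) → Step3 (.x a) (.y b)
  | xu {a b} : Sum.inr b ∈ f (Sum.inl a) → Step3 (.x a) (.u b)
  | vy {a b} : Sum.inl b ∈ f (Sum.inr a) → Step3 (.v a) (.y b)
  | vu {a b} : Sum.inr b ∈ f (Sum.inr a) → Step3 (.v a) (.u b)
  | yz {a b} : Sum.inl b ∈ g (Sum.inl a) → Step3 (.y a) (.z b)
  | yv {a b} : Sum.inr b ∈ g (Sum.inl a) → Step3 (.y a) (.v b)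
  | wz {a b} : Sum.inl b ∈ g (Sum.inr a) → Step3 (.w a) (.z b)
  | wv {a b} : Sum.inr b ∈ g (Sum.inr a) → Step3 (.w a) (.v b)
  | zt {a b} : Sum.inl b ∈ h (Sum.inl a) → Step3 (.z a) (.t b)
  | zw {a b} : Sum.inr b ∈ h (Sum.inl a) → Step3 (.z a) (.w b)
  | qt {a b} : Sum.inl b ∈ h (Sum.inr a) → Step3 (.q a) (.t b)
  | qw {a b} : Sum.inr b ∈ h (Sum.inr a) → Step3 (.q a) (.w b)

def win3 : X ⊕ Q → Wire3 X U Y V Z W T Q := Sum.elim .x .q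
def wout3 : T ⊕ U → Wire3 X U Y V Z W T Q := Sum.elim .t .u

/-- wires of `f ; g` -/
def embFG : Wire X U Y V Z W → Wire3 X U Y V Z W T Q
  | .x a => .x a | .u a => .u a | .y a => .y a | .v a => .v a | .z a => .z a | .w a => .w a
def embGH : Wire Y V Z W T Q → Wire3 X U Y V Z W T Q
  | .x a => .y a | .u a => .v a | .y a => .z a | .v a => .w a | .z a => .t a | .w a => .q a
/-- wires of `(f ; g) ; h` -/
def embL : Wire X U Z W T Q → Wire3 X U Y V Z W T Q
  | .x a => .x a | .u a => .u a | .y a => .z a | .v a => .w a | .z a => .t a | .w a => .q a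
/-- wires of `f ; (g ; h)` -/
def embR : Wire X U Y V T Q → Wire3 X U Y V Z W T Q
  | .x a => .x a | .u a => .u a | .y a => .y a | .v a => .v a | .z a => .t a | .w a => .q a

theorem path_FG {s t} (H : Relation.ReflTransGen (Step f g) s t) :
    Relation.ReflTransGen (Step3 f g h) (embFG s) (embFG t) := by
  refine Relation.ReflTransGen.lift embFG (fun a b hab => ?_) _ _ H
  cases hab <;> constructor <;> assumption

theorem path_GH {s t} (H : Relation.ReflTransGen (Step g h) s t) :
    Relation.ReflTransGen (Step3 f g h) (embGH s) (embGH t) := by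
  refine Relation.ReflTransGen.lift embGH (fun a b hab => ?_) _ _ H
  cases hab <;> constructor <;> assumption

theorem path_L {s t} (H : Relation.ReflTransGen (Step (intComp f g) h) s t) :
    Relation.ReflTransGen (Step3 f g h) (embL s) (embL t) := by
  refine Relation.ReflTransGen.lift' embL (fun a b hab => ?_) _ _ H
  cases hab with
  | xy k => exact path_FG f g h ((mem_intComp f g).1 k)
  | xu k => exact path_FG f g h ((mem_intComp f g).1 k)
  | vy k => exact path_FG f g h ((mem_intComp f g).1 k)
  | vu k => exact path_FG f g h ((mem_intComp f g).1 k)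
  | yz k => exact .single (.zt k)
  | yv k => exact .single (.zw k)
  | wz k => exact .single (.qt k)
  | wv k => exact .single (.qw k)

theorem path_R {s t} (H : Relation.ReflTransGen (Step f (intComp g h)) s t) :
    Relation.ReflTransGen (Step3 f g h) (embR s) (embR t) := by
  refine Relation.ReflTransGen.lift' embR (fun a b hab => ?_) _ _ H
  cases hab with
  | xy k => exact .single (.xy k)
  | xu k => exact .single (.xu k)
  | vy k => exact .single (.vy k)
  | vu k => exact .single (.vu k)
  | yz k => exact path_GH f g h ((mem_intComp g h).1 k)
  | yv k => exact path_GH f g h ((mem_intComp g h).1 k)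
  | wz k => exact path_GH f g h ((mem_intComp g h).1 k)
  | wv k => exact path_GH f g h ((mem_intComp g h).1 k)

def outL : Z ⊕ U → Wire X U Z W T Q := Sum.elim .y .u
def outR : T ⊕ V → Wire X U Y V T Q := Sum.elim .z .v

def FateL (o : T ⊕ U) : Wire3 X U Y V Z W T Q → Prop
  | .x a => Relation.ReflTransGen (Step (intComp f g) h) (.x a) (wout o)
  | .u a => Relation.ReflTransGen (Step (intComp f g) h) (.u a) (wout o)
  | .z a => Relation.ReflTransGen (Step (intComp f g) h) (.y a) (wout o)
  | .w a => Relation.ReflTransGen (Step (intComp f g) h) (.v a) (wout o)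
  | .t a => Relation.ReflTransGen (Step (intComp f g) h) (.z a) (wout o)
  | .q a => Relation.ReflTransGen (Step (intComp f g) h) (.w a) (wout o)
  | .y a => ∃ m, Relation.ReflTransGen (Step f g) (.y a) (wout m) ∧
      Relation.ReflTransGen (Step (intComp f g) h) (outL m) (wout o)
  | .v a => ∃ m, Relation.ReflTransGen (Step f g) (.v a) (wout m) ∧
      Relation.ReflTransGen (Step (intComp f g) h) (outL m) (wout o)

def FateR (o : T ⊕ U) : Wire3 X U Y V Z W T Q → Prop
  | .x a => Relation.ReflTransGen (Step f (intComp g h)) (.x a) (wout o)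
  | .u a => Relation.ReflTransGen (Step f (intComp g h)) (.u a) (wout o)
  | .y a => Relation.ReflTransGen (Step f (intComp g h)) (.y a) (wout o)
  | .v a => Relation.ReflTransGen (Step f (intComp g h)) (.v a) (wout o)
  | .t a => Relation.ReflTransGen (Step f (intComp g h)) (.z a) (wout o)
  | .q a => Relation.ReflTransGen (Step f (intComp g h)) (.w a) (wout o)
  | .z a => ∃ m, Relation.ReflTransGen (Step g h) (.y a) (wout m) ∧
      Relation.ReflTransGen (Step f (intComp g h)) (outR m) (wout o)
  | .w a => ∃ m, Relation.ReflTransGen (Step g h) (.v a) (wout m) ∧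
      Relation.ReflTransGen (Step f (intComp g h)) (outR m) (wout o)

theorem fateL {o : T ⊕ U} {s} (H : Relation.ReflTransGen (Step3 f g h) s (wout3 o)) :
    FateL f g h o s := by
  have hx : ∀ {a m}, Relation.ReflTransGen (Step f g) (.x a) (wout m) →
      Relation.ReflTransGen (Step (intComp f g) h) (outL m) (wout o) →
      Relation.ReflTransGen (Step (intComp f g) h) (.x a) (wout o) := by
    rintro a (m | m) h1 h2
    · exact .head (.xy ((mem_intComp f g (i := .inl a)).2 h1)) h2
    · exact .head (.xu ((mem_intComp f g (i := .inl a)).2 h1)) h2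
  have hw : ∀ {a m}, Relation.ReflTransGen (Step f g) (.w a) (wout m) →
      Relation.ReflTransGen (Step (intComp f g) h) (outL m) (wout o) →
      Relation.ReflTransGen (Step (intComp f g) h) (.v a) (wout o) := by
    rintro a (m | m) h1 h2
    · exact .head (.vy ((mem_intComp f g (i := .inr a)).2 h1)) h2
    · exact .head (.vu ((mem_intComp f g (i := .inr a)).2 h1)) h2
  induction H using Relation.ReflTransGen.head_induction_on with
  | refl => rcases o with o | o <;> exact .refl
  | head hs _ ih =>
    cases hs with
    | xy k => obtain ⟨m, h1, h2⟩ := ih; exact hx (.head (.xy k) h1) h2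
    | xu k => exact hx (m := .inr _) (.single (.xu k)) ih
    | vy k => obtain ⟨m, h1, h2⟩ := ih; exact ⟨m, .head (.vy k) h1, h2⟩
    | vu k => exact ⟨.inr _, .single (.vu k), ih⟩
    | yz k => exact ⟨.inl _, .single (.yz k), ih⟩
    | yv k => obtain ⟨m, h1, h2⟩ := ih; exact ⟨m, .head (.yv k) h1, h2⟩
    | wz k => exact hw (m := .inl _) (.single (.wz k)) ih
    | wv k => obtain ⟨m, h1, h2⟩ := ih; exact hw (.head (.wv k) h1) h2
    | zt k => exact .head (.yz k) ih
    | zw k => exact .head (.yv k) ih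
    | qt k => exact .head (.wz k) ih
    | qw k => exact .head (.wv k) ih

theorem fateR {o : T ⊕ U} {s} (H : Relation.ReflTransGen (Step3 f g h) s (wout3 o)) :
    FateR f g h o s := by
  have hy : ∀ {a m}, Relation.ReflTransGen (Step g h) (.x a) (wout m) →
      Relation.ReflTransGen (Step f (intComp g h)) (outR m) (wout o) →
      Relation.ReflTransGen (Step f (intComp g h)) (.y a) (wout o) := by
    rintro a (m | m) h1 h2
    · exact .head (.yz ((mem_intComp g h (i := .inl a)).2 h1)) h2
    · exact .head (.yv ((mem_intComp g h (i := .inl a)).2 h1)) h2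
  have hq : ∀ {a m}, Relation.ReflTransGen (Step g h) (.w a) (wout m) →
      Relation.ReflTransGen (Step f (intComp g h)) (outR m) (wout o) →
      Relation.ReflTransGen (Step f (intComp g h)) (.w a) (wout o) := by
    rintro a (m | m) h1 h2
    · exact .head (.wz ((mem_intComp g h (i := .inr a)).2 h1)) h2
    · exact .head (.wv ((mem_intComp g h (i := .inr a)).2 h1)) h2
  induction H using Relation.ReflTransGen.head_induction_on with
  | refl => rcases o with o | o <;> exact .refl
  | head hs _ ih =>
    cases hs with
    | xy k => exact .head (.xy k) ih
    | xu k => exact .head (.xu k) ih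
    | vy k => exact .head (.vy k) ih
    | vu k => exact .head (.vu k) ih
    | yz k => obtain ⟨m, h1, h2⟩ := ih; exact hy (.head (.xy k) h1) h2
    | yv k => exact hy (m := .inr _) (.single (.xu k)) ih
    | wz k => obtain ⟨m, h1, h2⟩ := ih; exact ⟨m, .head (.vy k) h1, h2⟩
    | wv k => exact ⟨.inr _, .single (.vu k), ih⟩
    | zt k => exact ⟨.inl _, .single (.yz k), ih⟩
    | zw k => obtain ⟨m, h1, h2⟩ := ih; exact ⟨m, .head (.yv k) h1, h2⟩
    | qt k => exact hq (m := .inl _) (.single (.wz k)) ih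
    | qw k => obtain ⟨m, h1, h2⟩ := ih; exact hq (.head (.wv k) h1) h2

theorem intComp_assoc : intComp (intComp f g) h = intComp f (intComp g h) := by
  refine ext_mem fun i o => ?_
  rw [mem_intComp, mem_intComp]
  constructor
  · intro H
    have H := path_L f g h H
    rcases i with i | i <;> rcases o with o | o <;> exact fateR f g h (o := by first | exact .inl o | exact .inr o) H
  · intro H
    have H := path_R f g h H
    rcases i with i | i <;> rcases o with o | o <;> exact fateL f g h (o := by first | exact .inl o | exact .inr o) H

end assoc

section pure
variable {X U Y V Z W : Type}

/-- The morphism `(X, U) ⟶ (Y, V)` given by a bijection `X ≃ Y` and a bijection `V ≃ U`. -/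
def intPure (p : X ≃ Y) (q : V ≃ U) : X ⊕ V ≃. Y ⊕ U := (p.sumCongr q).toPEquiv

theorem mem_intPure {p : X ≃ Y} {q : V ≃ U} {i o} :
    o ∈ intPure p q i ↔ Sum.map p q i = o := by
  simp [intPure, Equiv.toPEquiv_apply]

theorem mem_intPure_comp (p : X ≃ Y) (q : V ≃ U) (g : Y ⊕ W ≃. Z ⊕ V) {i o} :
    o ∈ intComp (intPure p q) g i ↔ ∃ t ∈ g (i.map p id), Sum.map id q t = o := by
  rw [mem_intComp]
  constructor
  · intro H
    let P : Wire X U Y V Z W → Prop := fun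
      | .x a => ∃ t ∈ g (.inl (p a)), Sum.map id q t = o
      | .y a => ∃ t ∈ g (.inl a), Sum.map id q t = o
      | .w a => ∃ t ∈ g (.inr a), Sum.map id q t = o
      | .v a => .inr (q a) = o
      | .u a => .inr a = o
      | .z a => .inl a = o
    have key : ∀ s, Relation.ReflTransGen (Step (intPure p q) g) s (wout o) → P s := by
      intro s H
      induction H using Relation.ReflTransGen.head_induction_on with
      | refl => rcases o with o | o <;> rfl
      | head hs _ ih =>
        cases hs with
        | xy k => cases mem_intPure.1 k; exact ih
        | xu k => cases mem_intPure.1 k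
        | vy k => cases mem_intPure.1 k
        | vu k => cases mem_intPure.1 k; exact ih
        | yz k => exact ⟨_, k, ih⟩
        | yv k => exact ⟨_, k, ih⟩
        | wz k => exact ⟨_, k, ih⟩
        | wv k => exact ⟨_, k, ih⟩
    rcases i with i | i <;> exact key _ H
  · rintro ⟨t, h, rfl⟩
    rcases i with i | i <;> rcases t with t | t
    · exact .head (.xy (mem_intPure.2 rfl)) (.single (.yz h))
    · exact .head (.xy (mem_intPure.2 rfl)) (.head (.yv h) (.single (.vu (mem_intPure.2 rfl))))
    · exact .single (.wz h)
    · exact .head (.wv h) (.single (.vu (mem_intPure.2 rfl)))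

theorem mem_comp_intPure (f : X ⊕ V ≃. Y ⊕ U) (p : Y ≃ Z) (q : W ≃ V) {i o} :
    o ∈ intComp f (intPure p q) i ↔ ∃ t ∈ f (i.map id q), Sum.map p id t = o := by
  rw [mem_intComp]
  constructor
  · intro H
    let P : Wire X U Y V Z W → Prop := fun
      | .x a => ∃ t ∈ f (.inl a), Sum.map p id t = o
      | .v a => ∃ t ∈ f (.inr a), Sum.map p id t = o
      | .w a => ∃ t ∈ f (.inr (q a)), Sum.map p id t = o
      | .y a => .inl (p a) = o
      | .u a => .inr a = o
      | .z a => .inl a = o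
    have key : ∀ s, Relation.ReflTransGen (Step f (intPure p q)) s (wout o) → P s := by
      intro s H
      induction H using Relation.ReflTransGen.head_induction_on with
      | refl => rcases o with o | o <;> rfl
      | head hs _ ih =>
        cases hs with
        | xy k => exact ⟨_, k, ih⟩
        | xu k => exact ⟨_, k, ih⟩
        | vy k => exact ⟨_, k, ih⟩
        | vu k => exact ⟨_, k, ih⟩
        | yz k => cases mem_intPure.1 k; exact ih
        | yv k => cases mem_intPure.1 k
        | wz k => cases mem_intPure.1 k
        | wv k => cases mem_intPure.1 k; exact ih
    rcases i with i | i <;> exact key _ H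
  · rintro ⟨t, h, rfl⟩
    rcases i with i | i <;> rcases t with t | t
    · exact .head (.xy h) (.single (.yz (mem_intPure.2 rfl)))
    · exact .single (.xu h)
    · exact .head (.wv (mem_intPure.2 rfl)) (.head (.vy h) (.single (.yz (mem_intPure.2 rfl))))
    · exact .head (.wv (mem_intPure.2 rfl)) (.single (.vu h))

theorem intPure_comp_intPure (p : X ≃ Y) (q : V ≃ U) (p' : Y ≃ Z) (q' : W ≃ V) :
    intComp (intPure p q) (intPure p' q') = intPure (p.trans p') (q'.trans q) := by
  refine ext_mem fun i o => ?_
  simp only [mem_intPure_comp, mem_intPure]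
  rcases i with i | i <;> simp

end pure

section tensor

/-- The tensor of `f : (X, U) ⟶ (Y, V)` and `f' : (X', U') ⟶ (Y', V')`, the composite
`(X ⊎ X') ⊎ (V' ⊎ V) ≅ (X ⊎ V) ⊎ (X' ⊎ V') ⇀ (Y ⊎ U) ⊎ (Y' ⊎ U') ≅ (Y ⊎ Y') ⊎ (U' ⊎ U)`
of symmetries with `f ⊎ f'`. -/
def intTensor {X U Y V X' U' Y' V' : Type} (f : X ⊕ V ≃. Y ⊕ U) (f' : X' ⊕ V' ≃. Y' ⊕ U') :
    (X ⊕ X') ⊕ (V' ⊕ V) ≃. (Y ⊕ Y') ⊕ (U' ⊕ U) :=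
  (((Equiv.refl (X ⊕ X')).sumCongr (Equiv.sumComm V' V)).trans
    (Equiv.sumSumSumComm X X' V V')).toPEquiv.trans <|
  (sumMap f f').trans
    ((Equiv.sumSumSumComm Y U Y' U').trans
      ((Equiv.refl (Y ⊕ Y')).sumCongr (Equiv.sumComm U U'))).toPEquiv

def left {A B A' B' : Type} : A ⊕ B → (A ⊕ A') ⊕ (B' ⊕ B) := Sum.map .inl .inr
def right {A B A' B' : Type} : A' ⊕ B' → (A ⊕ A') ⊕ (B' ⊕ B) := Sum.map .inr .inl

variable {X U Y V Z W X' U' Y' V' Z' W' : Type}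

theorem mem_intTensor_left (f : X ⊕ V ≃. Y ⊕ U) (f' : X' ⊕ V' ≃. Y' ⊕ U') {i o} :
    o ∈ intTensor f f' (left i) ↔ ∃ t ∈ f i, left t = o := by
  rcases i with i | i <;> rcases o with (o | o) | (o | o) <;>
    simp [intTensor, PEquiv.trans_eq_some, sumMap, Equiv.toPEquiv_apply, left,
      Equiv.sumSumSumComm]

theorem mem_intTensor_right (f : X ⊕ V ≃. Y ⊕ U) (f' : X' ⊕ V' ≃. Y' ⊕ U') {i o} :
    o ∈ intTensor f f' (right i) ↔ ∃ t ∈ f' i, right t = o := by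
  rcases i with i | i <;> rcases o with (o | o) | (o | o) <;>
    simp [intTensor, PEquiv.trans_eq_some, sumMap, Equiv.toPEquiv_apply, right,
      Equiv.sumSumSumComm]

theorem left_or_right {A B A' B' : Type} (i : (A ⊕ A') ⊕ (B' ⊕ B)) :
    (∃ j, i = left j) ∨ ∃ j, i = right j := by
  rcases i with (i | i) | (i | i)
  · exact .inl ⟨.inl i, rfl⟩
  · exact .inr ⟨.inl i, rfl⟩
  · exact .inr ⟨.inr i, rfl⟩
  · exact .inl ⟨.inr i, rfl⟩

def wl : Wire X U Y V Z W →
    Wire (X ⊕ X') (U' ⊕ U) (Y ⊕ Y') (V' ⊕ V) (Z ⊕ Z') (W' ⊕ W)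
  | .x a => .x (.inl a) | .u a => .u (.inr a) | .y a => .y (.inl a)
  | .v a => .v (.inr a) | .z a => .z (.inl a) | .w a => .w (.inr a)
def wr : Wire X' U' Y' V' Z' W' →
    Wire (X ⊕ X') (U' ⊕ U) (Y ⊕ Y') (V' ⊕ V) (Z ⊕ Z') (W' ⊕ W)
  | .x a => .x (.inr a) | .u a => .u (.inl a) | .y a => .y (.inr a)
  | .v a => .v (.inl a) | .z a => .z (.inr a) | .w a => .w (.inl a)

variable (f : X ⊕ V ≃. Y ⊕ U) (f' : X' ⊕ V' ≃. Y' ⊕ U')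
  (g : Y ⊕ W ≃. Z ⊕ V) (g' : Y' ⊕ W' ≃. Z' ⊕ V')

theorem step_wl {s t} : Step (intTensor f f') (intTensor g g') (wl s) t ↔
    ∃ t', Step f g s t' ∧ wl t' = t := by
  constructor
  · intro h
    generalize hs : wl s = s' at h
    cases h <;> cases s <;> cases hs <;> rename_i k
    · obtain ⟨(r | r), h1, h2⟩ := (mem_intTensor_left f f' (i := .inl _)).1 k <;> cases h2
      exact ⟨_, .xy h1, rfl⟩
    · obtain ⟨(r | r), h1, h2⟩ := (mem_intTensor_left f f' (i := .inl _)).1 k <;> cases h2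
      exact ⟨_, .xu h1, rfl⟩
    · obtain ⟨(r | r), h1, h2⟩ := (mem_intTensor_left f f' (i := .inr _)).1 k <;> cases h2
      exact ⟨_, .vy h1, rfl⟩
    · obtain ⟨(r | r), h1, h2⟩ := (mem_intTensor_left f f' (i := .inr _)).1 k <;> cases h2
      exact ⟨_, .vu h1, rfl⟩
    · obtain ⟨(r | r), h1, h2⟩ := (mem_intTensor_left g g' (i := .inl _)).1 k <;> cases h2
      exact ⟨_, .yz h1, rfl⟩
    · obtain ⟨(r | r), h1, h2⟩ := (mem_intTensor_left g g' (i := .inl _)).1 k <;> cases h2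
      exact ⟨_, .yv h1, rfl⟩
    · obtain ⟨(r | r), h1, h2⟩ := (mem_intTensor_left g g' (i := .inr _)).1 k <;> cases h2
      exact ⟨_, .wz h1, rfl⟩
    · obtain ⟨(r | r), h1, h2⟩ := (mem_intTensor_left g g' (i := .inr _)).1 k <;> cases h2
      exact ⟨_, .wv h1, rfl⟩
  · rintro ⟨t', h, rfl⟩
    cases h with
    | xy h => exact .xy ((mem_intTensor_left f f' (i := .inl _)).2 ⟨_, h, rfl⟩)
    | xu h => exact .xu ((mem_intTensor_left f f' (i := .inl _)).2 ⟨_, h, rfl⟩)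
    | vy h => exact .vy ((mem_intTensor_left f f' (i := .inr _)).2 ⟨_, h, rfl⟩)
    | vu h => exact .vu ((mem_intTensor_left f f' (i := .inr _)).2 ⟨_, h, rfl⟩)
    | yz h => exact .yz ((mem_intTensor_left g g' (i := .inl _)).2 ⟨_, h, rfl⟩)
    | yv h => exact .yv ((mem_intTensor_left g g' (i := .inl _)).2 ⟨_, h, rfl⟩)
    | wz h => exact .wz ((mem_intTensor_left g g' (i := .inr _)).2 ⟨_, h, rfl⟩)
    | wv h => exact .wv ((mem_intTensor_left g g' (i := .inr _)).2 ⟨_, h, rfl⟩)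

theorem step_wr {s t} : Step (intTensor f f') (intTensor g g') (wr s) t ↔
    ∃ t', Step f' g' s t' ∧ wr t' = t := by
  constructor
  · intro h
    generalize hs : wr s = s' at h
    cases h <;> cases s <;> cases hs <;> rename_i k
    · obtain ⟨(r | r), h1, h2⟩ := (mem_intTensor_right f f' (i := .inl _)).1 k <;> cases h2
      exact ⟨_, .xy h1, rfl⟩
    · obtain ⟨(r | r), h1, h2⟩ := (mem_intTensor_right f f' (i := .inl _)).1 k <;> cases h2
      exact ⟨_, .xu h1, rfl⟩
    · obtain ⟨(r | r), h1, h2⟩ := (mem_intTensor_right f f' (i := .inr _)).1 k <;> cases h2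
      exact ⟨_, .vy h1, rfl⟩
    · obtain ⟨(r | r), h1, h2⟩ := (mem_intTensor_right f f' (i := .inr _)).1 k <;> cases h2
      exact ⟨_, .vu h1, rfl⟩
    · obtain ⟨(r | r), h1, h2⟩ := (mem_intTensor_right g g' (i := .inl _)).1 k <;> cases h2
      exact ⟨_, .yz h1, rfl⟩
    · obtain ⟨(r | r), h1, h2⟩ := (mem_intTensor_right g g' (i := .inl _)).1 k <;> cases h2
      exact ⟨_, .yv h1, rfl⟩
    · obtain ⟨(r | r), h1, h2⟩ := (mem_intTensor_right g g' (i := .inr _)).1 k <;> cases h2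
      exact ⟨_, .wz h1, rfl⟩
    · obtain ⟨(r | r), h1, h2⟩ := (mem_intTensor_right g g' (i := .inr _)).1 k <;> cases h2
      exact ⟨_, .wv h1, rfl⟩
  · rintro ⟨t', h, rfl⟩
    cases h with
    | xy h => exact .xy ((mem_intTensor_right f f' (i := .inl _)).2 ⟨_, h, rfl⟩)
    | xu h => exact .xu ((mem_intTensor_right f f' (i := .inl _)).2 ⟨_, h, rfl⟩)
    | vy h => exact .vy ((mem_intTensor_right f f' (i := .inr _)).2 ⟨_, h, rfl⟩)
    | vu h => exact .vu ((mem_intTensor_right f f' (i := .inr _)).2 ⟨_, h, rfl⟩)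
    | yz h => exact .yz ((mem_intTensor_right g g' (i := .inl _)).2 ⟨_, h, rfl⟩)
    | yv h => exact .yv ((mem_intTensor_right g g' (i := .inl _)).2 ⟨_, h, rfl⟩)
    | wz h => exact .wz ((mem_intTensor_right g g' (i := .inr _)).2 ⟨_, h, rfl⟩)
    | wv h => exact .wv ((mem_intTensor_right g g' (i := .inr _)).2 ⟨_, h, rfl⟩)

theorem path_emb {S S' : Type} {R : S → S → Prop} {R' : S' → S' → Prop} (e : S → S')
    (he : ∀ s t, R' (e s) t ↔ ∃ t', R s t' ∧ e t' = t) {s t} :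
    Relation.ReflTransGen R' (e s) t ↔ ∃ t', Relation.ReflTransGen R s t' ∧ e t' = t := by
  constructor
  · intro h
    induction h with
    | refl => exact ⟨_, .refl, rfl⟩
    | tail _ h ih =>
      obtain ⟨t', h1, rfl⟩ := ih
      obtain ⟨t'', h2, rfl⟩ := (he _ _).1 h
      exact ⟨_, h1.tail h2, rfl⟩
  · rintro ⟨t', h, rfl⟩
    exact Relation.ReflTransGen.lift e (fun a b hab => (he _ _).2 ⟨_, hab, rfl⟩) _ _ h

theorem intTensor_comp_intTensor :
    intComp (intTensor f f') (intTensor g g') = intTensor (intComp f g) (intComp f' g') := by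
  refine ext_mem fun i o => ?_
  rw [mem_intComp]
  obtain ⟨j, rfl⟩ | ⟨j, rfl⟩ := left_or_right i
  · rw [mem_intTensor_left]
    have e : (win (left j) : Wire (X ⊕ X') (U' ⊕ U) (Y ⊕ Y') (V' ⊕ V) (Z ⊕ Z') (W' ⊕ W)) =
        wl (win j) := by rcases j with j | j <;> rfl
    rw [e, path_emb wl (fun s t => step_wl f f' g g')]
    constructor
    · rintro ⟨t, h, ht⟩
      rcases t with t | t | t | t | t | t <;> rcases o with (o | o) | (o | o) <;> cases ht
      · exact ⟨.inr _, (mem_intComp f g).2 h, rfl⟩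
      · exact ⟨.inl _, (mem_intComp f g).2 h, rfl⟩
    · rintro ⟨t, h, rfl⟩
      exact ⟨_, (mem_intComp f g).1 h, by rcases t with t | t <;> rfl⟩
  · rw [mem_intTensor_right]
    have e : (win (right j) : Wire (X ⊕ X') (U' ⊕ U) (Y ⊕ Y') (V' ⊕ V) (Z ⊕ Z') (W' ⊕ W)) =
        wr (win j) := by rcases j with j | j <;> rfl
    rw [e, path_emb wr (fun s t => step_wr f f' g g')]
    constructor
    · rintro ⟨t, h, ht⟩
      rcases t with t | t | t | t | t | t <;> rcases o with (o | o) | (o | o) <;> cases ht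
      · exact ⟨.inr _, (mem_intComp f' g').2 h, rfl⟩
      · exact ⟨.inl _, (mem_intComp f' g').2 h, rfl⟩
    · rintro ⟨t, h, rfl⟩
      exact ⟨_, (mem_intComp f' g').1 h, by rcases t with t | t <;> rfl⟩

end tensor
end PartialInj

/-- Sets, as the objects of the category of partial injections. -/
structure PInj where
  /-- The underlying set. -/
  carrier : Type

namespace PInj

/-- The category of partial injections. -/
instance : Category PInj where
  Hom X Y := X.carrier ≃. Y.carrier
  id X := PEquiv.refl X.carrier
  comp f g := PEquiv.trans f g
  id_comp := PEquiv.refl_trans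
  comp_id := PEquiv.trans_refl
  assoc := PEquiv.trans_assoc

/-- The natural numbers. -/
def nat : PInj := ⟨ℕ⟩

/-- The empty set. -/
def empty : PInj := ⟨Empty⟩

/-- Disjoint union of sets. -/
def sum (X Y : PInj) : PInj := ⟨X.carrier ⊕ Y.carrier⟩

/-- The sets generated by `ℕ` and the unit `∅` under disjoint union. -/
inductive Generated : ObjectProperty PInj
  | nat : Generated nat
  | empty : Generated empty
  | sum {X Y : PInj} : Generated X → Generated Y → Generated (sum X Y)

end PInj

/-- The category `pNat`: the full subcategory of partial injections on the sets generated by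
`ℕ` (and `∅`) under disjoint union. -/
abbrev NatPInj : Type 1 := PInj.Generated.FullSubcategory

namespace NatPInj

/-- The set underlying an object. -/
abbrev El (X : NatPInj) : Type := X.obj.carrier

/-- The natural numbers. -/
def nat : NatPInj := ⟨PInj.nat, .nat⟩

/-- The empty set. -/
def empty : NatPInj := ⟨PInj.empty, .empty⟩

/-- Disjoint union. -/
def sum (X Y : NatPInj) : NatPInj := ⟨PInj.sum X.obj Y.obj, .sum X.property Y.property⟩

end NatPInj

/-- Objects `(X, U)` of `Int(pNat)`. -/
structure IntPNat where
  /-- The first component `X`. -/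
  pos : NatPInj
  /-- The second component `U`. -/
  neg : NatPInj

namespace IntPNat

open PartialInj

/-- Morphisms `(X, U) ⟶ (Y, V)` are partial injections `X ⊎ V ⇀ Y ⊎ U`. -/
abbrev Hom (A B : IntPNat) : Type := A.pos.El ⊕ B.neg.El ≃. B.pos.El ⊕ A.neg.El

/-- The category `Int(pNat)`: identities are `1_X ⊎ 1_U`, and composition is by the trace. -/
noncomputable instance : Category IntPNat where
  Hom A B := Hom A B
  id A := intPure (Equiv.refl A.pos.El) (Equiv.refl A.neg.El)
  comp f g := intComp f g
  id_comp f := ext_mem fun i o => by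
    rw [mem_intPure_comp]; rcases i with i | i <;> simp [Sum.map_id_id]
  comp_id f := ext_mem fun i o => by
    rw [mem_comp_intPure]; rcases i with i | i <;> simp [Sum.map_id_id]
  assoc f g h := intComp_assoc f g h

/-- An isomorphism `(X, U) ≅ (Y, V)` from bijections `X ≃ Y` and `V ≃ U`. -/
def pureIso {A B : IntPNat} (p : A.pos.El ≃ B.pos.El) (q : B.neg.El ≃ A.neg.El) : A ≅ B where
  hom := intPure p q
  inv := intPure p.symm q.symm
  hom_inv_id := (intPure_comp_intPure p q p.symm q.symm).trans (by
    rw [p.self_trans_symm, q.symm_trans_self]; rfl)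
  inv_hom_id := (intPure_comp_intPure p.symm q.symm p q).trans (by
    rw [p.symm_trans_self, q.self_trans_symm]; rfl)

instance : IsEmpty NatPInj.empty.El := inferInstanceAs (IsEmpty Empty)

/-- The tensor `(X, U) □ (X', U') = (X ⊎ X', U' ⊎ U)` with unit `(∅, ∅)`, and the canonical
isomorphisms induced by those of disjoint union. -/
noncomputable instance : MonoidalCategoryStruct IntPNat where
  tensorObj A B := ⟨A.pos.sum B.pos, B.neg.sum A.neg⟩
  tensorUnit := ⟨NatPInj.empty, NatPInj.empty⟩
  tensorHom f g := intTensor f g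
  whiskerLeft A _ _ f := intTensor (intPure (Equiv.refl A.pos.El) (Equiv.refl A.neg.El)) f
  whiskerRight f A := intTensor f (intPure (Equiv.refl A.pos.El) (Equiv.refl A.neg.El))
  associator A B C := pureIso (Equiv.sumAssoc A.pos.El B.pos.El C.pos.El)
    (Equiv.sumAssoc C.neg.El B.neg.El A.neg.El)
  leftUnitor A := pureIso (Equiv.emptySum NatPInj.empty.El A.pos.El)
    (Equiv.sumEmpty A.neg.El NatPInj.empty.El).symm
  rightUnitor A := pureIso (Equiv.sumEmpty A.pos.El NatPInj.empty.El)
    (Equiv.emptySum NatPInj.empty.El A.neg.El).symm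

end IntPNat

namespace PartialInj

section
variable {X U Y V Z W X' U' Y' V' : Type}

theorem intPure_comp_apply (p : X ≃ Y) (q : V ≃ U) (g : Y ⊕ W ≃. Z ⊕ V) (i : X ⊕ W) :
    intComp (intPure p q) g i = (g (i.map p id)).map (Sum.map id q) :=
  Option.ext fun o => by
    rw [Option.map_eq_some_iff]; exact mem_intPure_comp p q g

theorem comp_intPure_apply (f : X ⊕ V ≃. Y ⊕ U) (p : Y ≃ Z) (q : W ≃ V) (i : X ⊕ W) :
    intComp f (intPure p q) i = (f (i.map id q)).map (Sum.map p id) :=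
  Option.ext fun o => by
    rw [Option.map_eq_some_iff]; exact mem_comp_intPure f p q

variable (f : X ⊕ V ≃. Y ⊕ U) (f' : X' ⊕ V' ≃. Y' ⊕ U')

theorem intTensor_ll (x : X) : intTensor f f' (.inl (.inl x)) = (f (.inl x)).map left :=
  Option.ext fun o => by
    rw [Option.map_eq_some_iff]; exact mem_intTensor_left f f' (i := .inl x)
theorem intTensor_rr (x : V) : intTensor f f' (.inr (.inr x)) = (f (.inr x)).map left :=
  Option.ext fun o => by
    rw [Option.map_eq_some_iff]; exact mem_intTensor_left f f' (i := .inr x)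
theorem intTensor_lr (x : X') : intTensor f f' (.inl (.inr x)) = (f' (.inl x)).map right :=
  Option.ext fun o => by
    rw [Option.map_eq_some_iff]; exact mem_intTensor_right f f' (i := .inl x)
theorem intTensor_rl (x : V') : intTensor f f' (.inr (.inl x)) = (f' (.inr x)).map right :=
  Option.ext fun o => by
    rw [Option.map_eq_some_iff]; exact mem_intTensor_right f f' (i := .inr x)

theorem intPure_apply (p : X ≃ Y) (q : V ≃ U) (i) : intPure p q i = some (i.map p q) := by
  simp [intPure, Equiv.toPEquiv_apply]

theorem intTensor_intPure (p : X ≃ Y) (q : V ≃ U) (p' : X' ≃ Y') (q' : V' ≃ U') :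
    intTensor (intPure p q) (intPure p' q') = intPure (p.sumCongr p') (q'.sumCongr q) := by
  refine PEquiv.ext fun i => ?_
  rcases i with (i | i) | (i | i) <;>
    simp [intTensor_ll, intTensor_lr, intTensor_rl, intTensor_rr, intPure_apply, left, right]
end

end PartialInj

namespace IntPNat
open PartialInj

theorem emptySum_swap_natural {X U Y V : Type} (f : X ⊕ V ≃. Y ⊕ U) :
   intComp (intTensor (intPure (Equiv.refl Empty) (Equiv.refl Empty)) f)
      (intPure (Equiv.emptySum Empty Y) (Equiv.sumEmpty V Empty).symm) =
   intComp (intPure (Equiv.emptySum Empty X) (Equiv.sumEmpty U Empty).symm) f := by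
  refine PEquiv.ext fun i => ?_
  rw [intPure_comp_apply, comp_intPure_apply]
  rcases i with (i | i) | i
  · exact i.elim
  · simp only [Sum.map_inl, intTensor_lr, Option.map_map, id_eq, Equiv.emptySum_apply_inr]
    congr 1; funext o; rcases o with o | o <;> rfl
  · simp only [Sum.map_inr, Equiv.sumEmpty_symm_apply, intTensor_rl, Option.map_map, id_eq]
    congr 1; funext o; rcases o with o | o <;> rfl

theorem sumEmpty_swap_natural {X U Y V : Type} (f : X ⊕ V ≃. Y ⊕ U) :
   intComp (intTensor f (intPure (Equiv.refl Empty) (Equiv.refl Empty)))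
      (intPure (Equiv.sumEmpty Y Empty) (Equiv.emptySum Empty V).symm) =
   intComp (intPure (Equiv.sumEmpty X Empty) (Equiv.emptySum Empty U).symm) f := by
  refine PEquiv.ext fun i => ?_
  rw [intPure_comp_apply, comp_intPure_apply]
  rcases i with (i | i) | i
  · simp only [Sum.map_inl, intTensor_ll, Option.map_map, id_eq, Equiv.sumEmpty_apply_inl]
    congr 1; funext o; rcases o with o | o <;> rfl
  · exact i.elim
  · simp only [Sum.map_inr, Equiv.emptySum_symm_apply, intTensor_rr, Option.map_map, id_eq]
    congr 1; funext o; rcases o with o | o <;> rfl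

theorem assoc_natural {X U Y V X' U' Y' V' X'' U'' Y'' V'' : Type} (f : X ⊕ V ≃. Y ⊕ U)
    (f' : X' ⊕ V' ≃. Y' ⊕ U') (f'' : X'' ⊕ V'' ≃. Y'' ⊕ U'') :
   intComp (intTensor (intTensor f f') f'')
      (intPure (Equiv.sumAssoc Y Y' Y'') (Equiv.sumAssoc V'' V' V)) =
   intComp (intPure (Equiv.sumAssoc X X' X'') (Equiv.sumAssoc U'' U' U))
      (intTensor f (intTensor f' f'')) := by
  refine PEquiv.ext fun i => ?_
  rw [intPure_comp_apply, comp_intPure_apply]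
  rcases i with ((i | i) | i) | ((i | i) | i) <;>
    simp only [Sum.map_inl, Sum.map_inr, Equiv.sumAssoc_apply_inl_inl,
      Equiv.sumAssoc_apply_inl_inr, Equiv.sumAssoc_apply_inr, intTensor_ll, intTensor_lr,
      intTensor_rl, intTensor_rr, Option.map_map, id_eq] <;>
    (congr 1; funext o; rcases o with o | o <;> rfl)

theorem braid_natural {X U Y V X' U' Y' V' : Type} (f : X ⊕ V ≃. Y ⊕ U)
    (f' : X' ⊕ V' ≃. Y' ⊕ U') :
   intComp (intTensor f f') (intPure (Equiv.sumComm Y Y') (Equiv.sumComm V V')) =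
   intComp (intPure (Equiv.sumComm X X') (Equiv.sumComm U U')) (intTensor f' f) := by
  refine PEquiv.ext fun i => ?_
  rw [intPure_comp_apply, comp_intPure_apply]
  rcases i with (i | i) | (i | i) <;>
    simp only [Sum.map_inl, Sum.map_inr, Equiv.sumComm_apply, Sum.swap_inl, Sum.swap_inr,
      intTensor_ll, intTensor_lr,
      intTensor_rl, intTensor_rr, Option.map_map, id_eq] <;>
    (congr 1; funext o; rcases o with o | o <;> rfl)

theorem pure_ext {X U Y V : Type} {p p' : X ≃ Y} {q q' : V ≃ U} (h : ∀ x, p x = p' x)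
    (h' : ∀ x, q x = q' x) : intPure p q = intPure p' q' := by
  rw [Equiv.ext h, Equiv.ext h']

noncomputable instance : MonoidalCategory IntPNat := .ofTensorHom
  (id_tensorHom_id := fun A B => (intTensor_intPure _ _ _ _).trans
    (pure_ext (by rintro (x | x) <;> rfl) (by rintro (x | x) <;> rfl)))
  (id_tensorHom := fun _ _ _ _ => rfl)
  (tensorHom_id := fun _ _ => rfl)
  (tensorHom_comp_tensorHom := fun f₁ f₂ g₁ g₂ => intTensor_comp_intTensor f₁ f₂ g₁ g₂)
  (associator_naturality := fun f g h => assoc_natural f g h)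
  (leftUnitor_naturality := fun f => emptySum_swap_natural f)
  (rightUnitor_naturality := fun f => sumEmpty_swap_natural f)
  (pentagon := fun A B C D => by
    refine (congrArg₂ (intComp) (intTensor_intPure _ _ _ _) (congrArg₂ intComp rfl
      (intTensor_intPure _ _ _ _))).trans ?_
    refine (congrArg₂ (intComp) rfl (intPure_comp_intPure _ _ _ _)).trans ?_
    refine (intPure_comp_intPure _ _ _ _).trans (.trans ?_ (intPure_comp_intPure _ _ _ _).symm)
    exact pure_ext (by rintro (((x | x) | x) | x) <;> rfl) (by rintro (((x | x) | x) | x) <;> rfl))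
  (triangle := fun A B => by
    refine (congrArg₂ (intComp) rfl (intTensor_intPure _ _ _ _)).trans ?_
    refine (intPure_comp_intPure _ _ _ _).trans (.trans ?_ (intTensor_intPure _ _ _ _).symm)
    refine pure_ext (by rintro ((x | x) | x) <;> first | rfl | exact x.elim)
      (by rintro (x | x) <;> rfl))

/-- The symmetry of `Int(pNat)`, given by the symmetry of disjoint union in both components. -/
noncomputable instance : SymmetricCategory IntPNat where
  braiding A B := pureIso (Equiv.sumComm A.pos.El B.pos.El) (Equiv.sumComm A.neg.El B.neg.El)
  braiding_naturality_right A B C f := braid_natural _ f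
  braiding_naturality_left f A := braid_natural f _
  hexagon_forward A B C := by
    refine (congrArg₂ intComp rfl (intPure_comp_intPure _ _ _ _)).trans ?_
    refine (intPure_comp_intPure _ _ _ _).trans ?_
    refine .trans ?_ (congrArg₂ intComp (intTensor_intPure _ _ _ _) (congrArg₂ intComp rfl
      (intTensor_intPure _ _ _ _))).symm
    refine .trans ?_ (congrArg₂ intComp rfl (intPure_comp_intPure _ _ _ _)).symm
    refine .trans ?_ (intPure_comp_intPure _ _ _ _).symm
    exact pure_ext (by rintro ((x | x) | x) <;> rfl) (by rintro ((x | x) | x) <;> rfl)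
  hexagon_reverse A B C := by
    refine (congrArg₂ intComp rfl (intPure_comp_intPure _ _ _ _)).trans ?_
    refine (intPure_comp_intPure _ _ _ _).trans ?_
    refine .trans ?_ (congrArg₂ intComp (intTensor_intPure _ _ _ _) (congrArg₂ intComp rfl
      (intTensor_intPure _ _ _ _))).symm
    refine .trans ?_ (congrArg₂ intComp rfl (intPure_comp_intPure _ _ _ _)).symm
    refine .trans ?_ (intPure_comp_intPure _ _ _ _).symm
    exact pure_ext (by rintro (x | (x | x)) <;> rfl) (by rintro (x | (x | x)) <;> rfl)
  symmetry A B := by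
    refine (intPure_comp_intPure _ _ _ _).trans ?_
    exact pure_ext (by rintro (x | x) <;> rfl) (by rintro (x | x) <;> rfl)

/-- The dual `(X, U)* = (U, X)`. -/
def dual (A : IntPNat) : IntPNat := ⟨A.neg, A.pos⟩

/-- The unit `η : (∅, ∅) ⟶ (X, U) □ (U, X)`, i.e. the symmetry
`∅ ⊎ (X ⊎ U) → (X ⊎ U) ⊎ ∅`. -/
def coev (A : IntPNat) : 𝟙_ IntPNat ⟶ A ⊗ A.dual :=
  (Equiv.sumComm NatPInj.empty.El (A.pos.El ⊕ A.neg.El)).toPEquiv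

/-- The counit `ε : (U, X) □ (X, U) ⟶ (∅, ∅)`, i.e. the symmetry
`(U ⊎ X) ⊎ ∅ → ∅ ⊎ (U ⊎ X)`. -/
def ev (A : IntPNat) : A.dual ⊗ A ⟶ 𝟙_ IntPNat :=
  (Equiv.sumComm (A.neg.El ⊕ A.pos.El) NatPInj.empty.El).toPEquiv

/-- The objects generated by `(ℕ, ℕ)` under the tensor and its unit. -/
inductive Generated : ObjectProperty IntPNat
  | nat : Generated ⟨.nat, .nat⟩
  | unit : Generated (𝟙_ IntPNat)
  | tensor {A B : IntPNat} : Generated A → Generated B → Generated (A ⊗ B)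

instance : Generated.IsMonoidal where
  prop_unit := .unit
  prop_tensor _ _ := .tensor

theorem Generated.dual {A : IntPNat} (h : Generated A) : Generated A.dual := by
  induction h with
  | nat => exact .nat
  | unit => exact .unit
  | tensor _ _ h₁ h₂ => exact .tensor h₂ h₁

end IntPNat

/-- The category `IpN`: the full monoidal subcategory of `Int(pNat)` generated by `(ℕ, ℕ)`. Its
symmetric monoidal structure is the one inherited from `Int(pNat)`. -/
abbrev IpN : Type 1 := IntPNat.Generated.FullSubcategory

namespace IpN

/-- The dual in `IpN`, which is the dual in `Int(pNat)`. -/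
def dual (A : IpN) : IpN := ⟨A.obj.dual, A.property.dual⟩

/-- The unit in `IpN`, which is the unit in `Int(pNat)`. -/
noncomputable def coev (A : IpN) : 𝟙_ IpN ⟶ A ⊗ A.dual := ObjectProperty.homMk A.obj.coev

/-- The counit in `IpN`, which is the counit in `Int(pNat)`. -/
noncomputable def ev (A : IpN) : A.dual ⊗ A ⟶ 𝟙_ IpN := ObjectProperty.homMk A.obj.ev

end IpN

/-! Compact closure. Composition in `Int` follows a token along wires: by `mem_intComp`, an output
belongs to the composite at an input exactly when a path of passes through the two morphisms joins
them. In these terms η and ε are pure turn-backs. A token that enters ε on a positive wire leaves on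
the negative wire with the same label, and a token that enters η on a negative wire leaves on the
positive one. Each triangle composite is therefore a zigzag: a token runs along an identity strand,
is turned back twice, once by each of η and ε, and leaves along the other identity strand with its
label unchanged. The other side of the triangle is a composite of unitors, which is pure, that is,
given by total bijections on the two components. A partial injection whose graph contains that of a
total map equals it (`eq_intPure_of_mem`), so it is enough to exhibit one path per input token. The
tensor and duality of `IpN` are those of `Int(pNat)`, and the triangles restrict.

Isomorphisms. Since ℕ ⊎ ℕ ≃ ℕ, every set generated from ℕ and ∅ is either empty or in bijection with
ℕ. Bijections X ≃ Y and V ≃ U give an isomorphism (X, U) ≅ (Y, V), so all objects with two nonempty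
components are isomorphic. In `IpN` both components are empty or both are countably infinite,
because the generators have this property and □ preserves it. In the first case the object is
isomorphic to the unit, so every non-unit object falls under the second. -/

namespace PartialInj

/-- Since `p` and `q` are total, the two hypotheses already fix the value of `f` at every input. In
the triangle identities this leaves one path to exhibit for each input, with no need to exclude
others. -/
theorem eq_intPure_of_mem {X U Y V : Type} {f : X ⊕ V ≃. Y ⊕ U} {p : X ≃ Y} {q : V ≃ U}
    (hl : ∀ x, Sum.inl (p x) ∈ f (Sum.inl x)) (hr : ∀ v, Sum.inr (q v) ∈ f (Sum.inr v)) :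
    f = intPure p q := by
  refine PEquiv.ext fun i => ?_
  rw [intPure_apply]
  rcases i with i | i
  · exact hl i
  · exact hr i

end PartialInj

/-! ### Cardinality of the objects of pNat -/

namespace PInj

/-- The dichotomy survives disjoint union because an empty summand can be dropped and ℕ ⊎ ℕ ≃ ℕ. -/
theorem Generated.isEmpty_or_equiv_nat {X : PInj} (h : Generated X) :
    IsEmpty X.carrier ∨ Nonempty (X.carrier ≃ ℕ) := by
  induction h with
  | nat => exact .inr ⟨Equiv.refl ℕ⟩
  | empty => exact .inl (inferInstanceAs (IsEmpty Empty))
  | @sum X Y _ _ hX hY =>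
    change IsEmpty (X.carrier ⊕ Y.carrier) ∨ Nonempty (X.carrier ⊕ Y.carrier ≃ ℕ)
    rcases hX with hX | ⟨⟨e⟩⟩ <;> rcases hY with hY | ⟨⟨e'⟩⟩
    · exact .inl inferInstance
    · exact .inr ⟨(Equiv.emptySum _ _).trans e'⟩
    · exact .inr ⟨(Equiv.sumEmpty _ _).trans e⟩
    · exact .inr ⟨(e.sumCongr e').trans Equiv.natSumNatEquivNat⟩

end PInj

namespace NatPInj

/-- A bijection between the underlying sets is an isomorphism of partial injections. -/
def isoOfEquiv {X Y : NatPInj} (e : X.El ≃ Y.El) : X ≅ Y where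
  hom := ObjectProperty.homMk e.toPEquiv
  inv := ObjectProperty.homMk e.symm.toPEquiv
  hom_inv_id := by
    ext : 1
    exact (e.toPEquiv_trans e.symm).symm.trans (by rw [e.self_trans_symm]; rfl)
  inv_hom_id := by
    ext : 1
    exact (e.symm.toPEquiv_trans e).symm.trans (by rw [e.symm_trans_self]; rfl)

/-- An empty set is isomorphic to ∅ through the empty bijection, so the hypothesis leaves only the
infinite case of the dichotomy. -/
theorem nonempty_equiv_nat {X : NatPInj} (h : IsEmpty (X ≅ empty)) : Nonempty (X.El ≃ ℕ) := by
  refine X.property.isEmpty_or_equiv_nat.resolve_left fun hX => ?_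
  have : IsEmpty X.El := hX
  exact h.false (isoOfEquiv (Equiv.equivOfIsEmpty X.El empty.El))

end NatPInj

/-! ### Duality and isomorphisms in Int(pNat) -/

namespace IntPNat
open PartialInj

/-- The unit and counit exhibit `(U, X)` as a dual of `(X, U)`. -/
noncomputable abbrev exactPairing (A : IntPNat) : ExactPairing A A.dual where
  coevaluation' := A.coev
  evaluation' := A.ev
  coevaluation_evaluation' := by
    -- The right-hand side is a right unitor followed by an inverse left unitor, hence pure. It
    -- remains to trace a positive token of U and a negative token of X through the zigzag on (U,
    -- X).
    refine .trans (eq_intPure_of_mem ?_ ?_) (intPure_comp_intPure _ _ _ _).symm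
    · rintro (u | x)
      -- Path of a positive token: identity strand beside η, turned back by ε, turned forward by η,
      -- identity strand beside ε. The witnesses given to `mem_intPure_comp` are the outputs of the
      -- whiskered counit, before the associator relabels them.
      · refine (mem_intComp _ _).2 (.head (.xy (b := .inl u) rfl) ?_)
        refine .head (.yv (b := .inl (.inr u))
          ((mem_intPure_comp _ _ _).2 ⟨.inr (.inr (.inl u)), rfl, rfl⟩)) ?_
        refine .head (.vy (b := .inr (.inr u)) rfl) (.single (.yz ?_))
        exact (mem_intPure_comp _ _ _).2 ⟨.inl (.inr u), rfl, rfl⟩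
      -- This summand comes from the unit object and is empty.
      · exact x.elim
    · rintro (x | x)
      -- A negative token enters at the codomain end, so it meets the second morphism first:
      -- identity strand beside ε, then η, then ε, then the identity strand beside η.
      · refine (mem_intComp _ _).2 (.head (.wv (b := .inl (.inl x))
          ((mem_intPure_comp _ _ _).2 ⟨.inr (.inl x), rfl, rfl⟩)) ?_)
        refine .head (.vy (b := .inr (.inl x)) rfl) ?_
        refine .head (.yv (b := .inr x)
          ((mem_intPure_comp _ _ _).2 ⟨.inr (.inr (.inr x)), rfl, rfl⟩)) ?_
        exact .single (.vu rfl)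
      · exact x.elim
  evaluation_coevaluation' := by
    -- The mirror zigzag on (X, U): η and ε now sit on the other side of the identity strand, and
    -- the empty summand comes first on the input side. The order of passes is as before.
    refine .trans (eq_intPure_of_mem ?_ ?_) (intPure_comp_intPure _ _ _ _).symm
    · rintro (x | x)
      · exact x.elim
      · refine (mem_intComp _ _).2 (.head (.xy (b := .inr x) rfl) ?_)
        refine .head (.yv (b := .inr (.inl x))
          ((mem_intPure_comp _ _ _).2 ⟨.inr (.inl (.inr x)), rfl, rfl⟩)) ?_
        refine .head (.vy (b := .inl (.inl x)) rfl) (.single (.yz ?_))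
        exact (mem_intPure_comp _ _ _).2 ⟨.inl (.inl x), rfl, rfl⟩
    · rintro (u | u)
      · exact u.elim
      · refine (mem_intComp _ _).2 (.head (.wv (b := .inr (.inr u))
          ((mem_intPure_comp _ _ _).2 ⟨.inr (.inr u), rfl, rfl⟩)) ?_)
        refine .head (.vy (b := .inl (.inr u)) rfl) ?_
        refine .head (.yv (b := .inl u)
          ((mem_intPure_comp _ _ _).2 ⟨.inr (.inl (.inl u)), rfl, rfl⟩)) ?_
        exact .single (.vu rfl)

/-- Each bijection passes through ℕ. The one on second components runs from `B` to `A`, because an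
`Int` morphism is contravariant there. -/
theorem nonempty_iso_of_equiv_nat {A B : IntPNat} (hp : Nonempty (A.pos.El ≃ ℕ))
    (hn : Nonempty (A.neg.El ≃ ℕ)) (hp' : Nonempty (B.pos.El ≃ ℕ))
    (hn' : Nonempty (B.neg.El ≃ ℕ)) : Nonempty (A ≅ B) :=
  ⟨pureIso (hp.some.trans hp'.some.symm) (hn'.some.trans hn.some.symm)⟩

/-- The two components must be handled together: separate dichotomies would allow mixed objects such
as (ℕ, ∅), which exist in `Int(pNat)` but are not generated by (ℕ, ℕ). In the tensor case the
negative components appear in reversed order. -/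
theorem Generated.isEmpty_or_equiv_nat {A : IntPNat} (h : Generated A) :
    (IsEmpty A.pos.El ∧ IsEmpty A.neg.El) ∨
      (Nonempty (A.pos.El ≃ ℕ) ∧ Nonempty (A.neg.El ≃ ℕ)) := by
  induction h with
  | nat => exact .inr ⟨⟨Equiv.refl ℕ⟩, ⟨Equiv.refl ℕ⟩⟩
  | unit => exact .inl ⟨inferInstanceAs (IsEmpty Empty), inferInstanceAs (IsEmpty Empty)⟩
  | @tensor A B _ _ hA hB =>
    change (IsEmpty (A.pos.El ⊕ B.pos.El) ∧ IsEmpty (B.neg.El ⊕ A.neg.El)) ∨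
      (Nonempty (A.pos.El ⊕ B.pos.El ≃ ℕ) ∧ Nonempty (B.neg.El ⊕ A.neg.El ≃ ℕ))
    rcases hA with ⟨hA, hA'⟩ | ⟨⟨e⟩, ⟨e'⟩⟩ <;> rcases hB with ⟨hB, hB'⟩ | ⟨⟨d⟩, ⟨d'⟩⟩
    · exact .inl ⟨inferInstance, inferInstance⟩
    · exact .inr ⟨⟨(Equiv.emptySum _ _).trans d⟩, ⟨(Equiv.sumEmpty _ _).trans d'⟩⟩
    · exact .inr ⟨⟨(Equiv.sumEmpty _ _).trans e⟩, ⟨(Equiv.emptySum _ _).trans e'⟩⟩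
    · exact .inr ⟨⟨(e.sumCongr d).trans Equiv.natSumNatEquivNat⟩,
        ⟨(d'.sumCongr e').trans Equiv.natSumNatEquivNat⟩⟩

end IntPNat

/-! ### Restriction to IpN -/

namespace IpN

/-- The duality of `Int(pNat)` restricts to `IpN`. -/
noncomputable abbrev exactPairing (A : IpN) : ExactPairing A A.dual where
  coevaluation' := A.coev
  evaluation' := A.ev
  coevaluation_evaluation' := by
    -- A morphism of the full subcategory is determined by its underlying morphism, and the monoidal
    -- structure is inherited, so the triangle becomes the one in `Int(pNat)`.
    ext : 1
    exact A.obj.exactPairing.coevaluation_evaluation'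
  evaluation_coevaluation' := by
    ext : 1
    exact A.obj.exactPairing.evaluation_coevaluation'

/-- If both components were empty, the empty bijections would give an isomorphism with the unit in
`Int(pNat)`, which lifts to `IpN` by fullness. -/
theorem equiv_nat_of_not_unit {A : IpN} (h : IsEmpty (A ≅ 𝟙_ IpN)) :
    Nonempty (A.obj.pos.El ≃ ℕ) ∧ Nonempty (A.obj.neg.El ≃ ℕ) := by
  refine A.property.isEmpty_or_equiv_nat.resolve_left fun ⟨hp, hn⟩ => ?_
  have e : A.obj ≅ 𝟙_ IntPNat :=
    IntPNat.pureIso (B := 𝟙_ IntPNat) (Equiv.equivOfIsEmpty A.obj.pos.El NatPInj.empty.El)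
      (Equiv.equivOfIsEmpty NatPInj.empty.El A.obj.neg.El)
  exact h.false (ObjectProperty.isoMk _ e)

end IpN

theorem mainTheorem9 :
    -- `Int(pNat)` is compact closed
    IsCompactClosed IntPNat.dual IntPNat.coev IntPNat.ev ∧
    -- all objects `(X, U)` of `Int(pNat)` with `X ≇ ∅ ≇ U` are isomorphic
    (∀ A B : IntPNat,
      IsEmpty (A.pos ≅ NatPInj.empty) → IsEmpty (A.neg ≅ NatPInj.empty) →
      IsEmpty (B.pos ≅ NatPInj.empty) → IsEmpty (B.neg ≅ NatPInj.empty) →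
      Nonempty (A ≅ B)) ∧
    -- `IpN` is compact closed
    IsCompactClosed IpN.dual IpN.coev IpN.ev ∧
    -- all non-unit objects of `IpN` are isomorphic
    (∀ A B : IpN,
      IsEmpty (A ≅ 𝟙_ IpN) → IsEmpty (B ≅ 𝟙_ IpN) → Nonempty (A ≅ B)) := by
  refine ⟨fun A => ⟨A.exactPairing, rfl, rfl⟩, fun A B hA hA' hB hB' => ?_,
    fun A => ⟨A.exactPairing, rfl, rfl⟩, fun A B hA hB => ?_⟩
  · exact IntPNat.nonempty_iso_of_equiv_nat (NatPInj.nonempty_equiv_nat hA)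
      (NatPInj.nonempty_equiv_nat hA') (NatPInj.nonempty_equiv_nat hB)
      (NatPInj.nonempty_equiv_nat hB')
  · obtain ⟨hp, hn⟩ := IpN.equiv_nat_of_not_unit hA
    obtain ⟨hp', hn'⟩ := IpN.equiv_nat_of_not_unit hB
    -- Fullness again: an isomorphism of the underlying objects of `Int(pNat)` is one in `IpN`.
    exact (IntPNat.nonempty_iso_of_equiv_nat hp hn hp' hn').map (ObjectProperty.isoMk _)
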